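/- Let $G$ be a finite simple graph. For a vertex $v$, let $N(v)$ be the set of neighbors of $v$ and $N[v]=N(v)\cup\{v\}$. A set $B\subseteq V(G)$ is a $k$-limited packing if $|B\cap N[v]|\le k$ for every $v\in V(G)$, and a $k$-total limited packing if $|B\cap N(v)|\le k$ for every $v\in V(G)$. Let $L_k(G)$ and $L_{k,t}(G)$ denote the maximum cardinality of a $k$-limited packing and of a $k$-total limited packing in $G$, respectively. **Theorem.** If $T$ is a tree of order $n$, then $L_{2,t}(T)-L_2(T)\le\lfloor n/3\rfloor$. Moreover, this bound is sharp: for every integer $n\ge 1$ there is a tree $T$ of order $n$ with $L_{2,t}(T)-L_2(T)=\lfloor n/3\rfloor$. -/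

import Mathlib

namespace SimpleGraph

variable {V : Type*}

/-- The open neighborhood `N(v)` contains all vertices adjacent to `v`; a set `B` of vertices is a
`k`-total limited packing if `|B ∩ N(v)| ≤ k` for every vertex `v`. -/
def IsTotalLimitedPacking (G : SimpleGraph V) (k : ℕ) (B : Finset V) : Prop :=
  ∀ v : V, ((B : Set V) ∩ G.neighborSet v).ncard ≤ k

/-- The closed neighborhood is `N[v] = N(v) ∪ {v}`; a set `B` of vertices is a
`k`-limited packing if `|B ∩ N[v]| ≤ k` for every vertex `v`. -/
def IsLimitedPacking (G : SimpleGraph V) (k : ℕ) (B : Finset V) : Prop :=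
  ∀ v : V, ((B : Set V) ∩ insert v (G.neighborSet v)).ncard ≤ k

open Classical in
/-- The `k`-limited packing number `L_k(G)`: the maximum cardinality of a `k`-limited packing. -/
noncomputable def limitedPackingNumber [Fintype V] (G : SimpleGraph V) (k : ℕ) : ℕ :=
  (Finset.univ.filter fun B : Finset V => G.IsLimitedPacking k B).sup Finset.card

open Classical in
/-- The `k`-total limited packing number `L_{k,t}(G)`: the maximum cardinality of a `k`-total
limited packing. -/
noncomputable def totalLimitedPackingNumber [Fintype V] (G : SimpleGraph V) (k : ℕ) : ℕ :=
  (Finset.univ.filter fun B : Finset V => G.IsTotalLimitedPacking k B).sup Finset.card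

end SimpleGraph

namespace SimpleGraph

variable {V : Type*} {G : SimpleGraph V}

/-! Given a 2-total limited packing `B` of a tree, colour `B` with three colours so that the members
of `B` in each closed neighbourhood centred in `B` are coloured distinctly; there are at most three
of them. Deleting a smallest colour class leaves at most two in each such neighbourhood, while at a
centre outside the remaining set the closed condition is the open one. For sharpness take paths: all
vertices form a 2-total limited packing, but a 2-limited packing misses a vertex of every three
consecutive ones. -/

theorem IsTree.parent_unique (hG : G.IsTree) {r v u w : V} (hu : G.Adj u v) (hw : G.Adj w v)
    (hru : G.dist r v = G.dist r u + 1) (hrw : G.dist r v = G.dist r w + 1) : u = w := by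
  obtain ⟨p, hp⟩ := hG.connected.exists_walk_length_eq_dist r u
  obtain ⟨q, hq⟩ := hG.connected.exists_walk_length_eq_dist r w
  have hp' : (p.concat hu).IsPath := Walk.isPath_of_length_eq_dist _ (by simp [hp, hru])
  have hq' : (q.concat hw).IsPath := Walk.isPath_of_length_eq_dist _ (by simp [hq, hrw])
  have h : p.concat hu = q.concat hw :=
    congrArg Subtype.val ((hG.isAcyclic.subsingleton_path r v).elim ⟨_, hp'⟩ ⟨_, hq'⟩)
  simpa using congrArg Walk.penultimate h

/-- Every nonempty finite set of vertices of a tree contains a vertex with at most one neighbour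
in the set. -/
theorem IsTree.exists_mem_subsingleton_inter_neighborSet (hG : G.IsTree) {B : Finset V}
    (hB : B.Nonempty) :
    ∃ v ∈ B, ((B : Set V) ∩ G.neighborSet v).Subsingleton := by
  obtain ⟨r, -⟩ := id hB
  -- At a vertex of `B` farthest from `r`, any neighbour in `B` is strictly closer to `r`, hence is
  -- the unique parent.
  obtain ⟨v, hv, hmax⟩ := B.exists_max_image (G.dist r) hB
  refine ⟨v, hv, ?_⟩
  have key : ∀ u ∈ (B : Set V) ∩ G.neighborSet v, G.Adj u v ∧ G.dist r v = G.dist r u + 1 := by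
    rintro u ⟨huB, huv⟩
    rw [mem_neighborSet] at huv
    have h1 := hmax u huB
    have h2 := hG.dist_eq_dist_add_one_of_adj r huv
    exact ⟨huv.symm, by omega⟩
  intro u hu w hw
  exact hG.parent_unique (key u hu).1 (key w hw).1 (key u hu).2 (key w hw).2

theorem IsTotalLimitedPacking.mono {k : ℕ} {B C : Finset V} (hB : G.IsTotalLimitedPacking k B)
    (hCB : C ⊆ B) : G.IsTotalLimitedPacking k C := fun v =>
  (Set.ncard_le_ncard (Set.inter_subset_inter_left _ (Finset.coe_subset.2 hCB))
    (B.finite_toSet.inter_of_left _)).trans (hB v)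

/-- The square of the subgraph of a tree induced by a 2-total limited packing is 3-colourable. -/
theorem IsTree.exists_coloring_of_isTotalLimitedPacking (hG : G.IsTree) (B : Finset V)
    (hB : G.IsTotalLimitedPacking 2 B) :
    ∃ c : V → Fin 3, ∀ v ∈ B, Set.InjOn c ((B : Set V) ∩ insert v (G.neighborSet v)) := by
  classical
  induction B using Finset.strongInduction with
  | H B ih =>
    obtain rfl | hne := B.eq_empty_or_nonempty
    · exact ⟨fun _ => 0, by simp⟩
    obtain ⟨v, hv, hsub⟩ := hG.exists_mem_subsingleton_inter_neighborSet hne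
    obtain ⟨c, hc⟩ := ih (B.erase v) (Finset.erase_ssubset hv) (hB.mono (Finset.erase_subset _ _))
    by_cases hleaf : ∃ u ∈ B, G.Adj v u
    · obtain ⟨u, huB, hvu⟩ := hleaf
      have huniq : ∀ x ∈ B, G.Adj v x → x = u := fun x hx hvx => hsub ⟨hx, hvx⟩ ⟨huB, hvu⟩
      have hother : (((B : Set V) ∩ G.neighborSet u) \ {v}).ncard ≤ 1 := by
        have h1 := hB u
        have h2 := Set.ncard_sdiff_singleton_add_one
          (show v ∈ (B : Set V) ∩ G.neighborSet u from ⟨hv, hvu.symm⟩)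
          (B.finite_toSet.inter_of_left _)
        omega
      rw [Set.ncard_le_one (B.finite_toSet.inter_of_left _).sdiff] at hother
      -- The colour of `v` must avoid only `u` and the at most one other neighbour of `u` in `B`, so
      -- three colours suffice.
      obtain ⟨a, ha⟩ : ∃ a : Fin 3, a ≠ c u ∧ ∀ x ∈ B, G.Adj u x → x ≠ v → a ≠ c x := by
        by_cases hx : ∃ x ∈ B, G.Adj u x ∧ x ≠ v
        · obtain ⟨x, hxB, hux, hxv⟩ := hx
          obtain ⟨a, ha⟩ : ∃ a : Fin 3, a ≠ c u ∧ a ≠ c x := by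
            generalize c u = i
            generalize c x = j
            revert i j
            decide
          refine ⟨a, ha.1, fun y hyB huy hyv => ?_⟩
          rw [hother y ⟨⟨hyB, huy⟩, hyv⟩ x ⟨⟨hxB, hux⟩, hxv⟩]
          exact ha.2
        · push Not at hx
          obtain ⟨a, ha⟩ := exists_ne (c u)
          exact ⟨a, ha, fun y hyB huy hyv => (hyv (hx y hyB huy)).elim⟩
      refine ⟨Function.update c v a, fun w hw => ?_⟩
      -- Only the closed neighbourhoods of `v` and `u`, among those centred in `B`, contain `v`.
      have hnew : ∀ x ∈ B, x ≠ v → (x = w ∨ G.Adj w x) → (v = w ∨ G.Adj w v) → a ≠ c x := by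
        rintro x hxB hxv hx (rfl | hwv)
        · obtain rfl := huniq x hxB (hx.resolve_left hxv)
          exact ha.1
        · obtain rfl := huniq w hw hwv.symm
          obtain rfl | hx := hx
          · exact ha.1
          · exact ha.2 x hxB hx hxv
      rintro x ⟨hxB, hx⟩ y ⟨hyB, hy⟩ hxy
      simp only [Set.mem_insert_iff, mem_neighborSet] at hx hy
      rw [Finset.mem_coe] at hxB hyB
      by_cases hxv : x = v <;> by_cases hyv : y = v
      · rw [hxv, hyv]
      · subst hxv
        rw [Function.update_self, Function.update_of_ne hyv] at hxy
        exact (hnew y hyB hyv hy hx hxy).elim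
      · subst hyv
        rw [Function.update_self, Function.update_of_ne hxv] at hxy
        exact (hnew x hxB hxv hx hy hxy.symm).elim
      · rw [Function.update_of_ne hxv, Function.update_of_ne hyv] at hxy
        by_cases hwv : w = v
        · subst hwv
          rw [huniq x hxB (hx.resolve_left hxv), huniq y hyB (hy.resolve_left hyv)]
        · exact hc w (Finset.mem_erase.2 ⟨hwv, hw⟩) ⟨by simp [hxv, hxB], hx⟩
            ⟨by simp [hyv, hyB], hy⟩ hxy
    · push Not at hleaf
      refine ⟨c, fun w hw => ?_⟩
      rintro x ⟨hxB, hx⟩ y ⟨hyB, hy⟩ hxy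
      simp only [Set.mem_insert_iff, mem_neighborSet] at hx hy
      rw [Finset.mem_coe] at hxB hyB
      by_cases hwv : w = v
      · subst hwv
        rw [hx.resolve_right (hleaf x hxB), hy.resolve_right (hleaf y hyB)]
      · have hwv' : ¬ G.Adj w v := fun h => hleaf w hw h.symm
        have hne : ∀ z, z = w ∨ G.Adj w z → z ≠ v := by
          rintro z hz rfl
          exact hz.elim (fun h => hwv h.symm) hwv'
        exact hc w (Finset.mem_erase.2 ⟨hwv, hw⟩) ⟨by simp [hne x hx, hxB], hx⟩
          ⟨by simp [hne y hy, hyB], hy⟩ hxy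

/-- A 2-total limited packing of a tree becomes a 2-limited packing after deleting at most a third
of its vertices. -/
theorem IsTree.exists_isLimitedPacking_subset (hG : G.IsTree) {B : Finset V}
    (hB : G.IsTotalLimitedPacking 2 B) :
    ∃ C ⊆ B, G.IsLimitedPacking 2 C ∧ B.card ≤ C.card + B.card / 3 := by
  classical
  obtain ⟨c, hc⟩ := hG.exists_coloring_of_isTotalLimitedPacking B hB
  obtain ⟨i, -, hi⟩ := Finset.exists_card_fiber_le_of_card_le_nsmul (s := B)
    (t := (Finset.univ : Finset (Fin 3))) (f := c) (b := (B.card / 3 : ℚ)) Finset.univ_nonempty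
    (by simp; linarith)
  refine ⟨B.filter (c · ≠ i), Finset.filter_subset _ _, fun v => ?_, ?_⟩
  · by_cases hv : v ∈ B.filter (c · ≠ i)
    · rw [Finset.mem_filter] at hv
      have hmaps : Set.MapsTo c ((B.filter (c · ≠ i) : Set V) ∩ insert v (G.neighborSet v))
          ((Finset.univ.erase i : Finset (Fin 3)) : Set (Fin 3)) := by
        rintro x ⟨hx, -⟩
        simpa using (Finset.mem_filter.1 hx).2
      have hinj : Set.InjOn c ((B.filter (c · ≠ i) : Set V) ∩ insert v (G.neighborSet v)) :=
        (hc v hv.1).mono (Set.inter_subset_inter_left _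
          (Finset.coe_subset.2 (Finset.filter_subset _ _)))
      have := Set.ncard_le_ncard_of_injOn c hmaps hinj (Finset.finite_toSet _)
      rwa [Set.ncard_coe_finset, Finset.card_erase_of_mem (Finset.mem_univ _),
        Finset.card_fin] at this
    · rw [Set.inter_insert_of_notMem (by simpa using hv)]
      exact hB.mono (Finset.filter_subset _ _) v
  · have h1 := Finset.card_filter_add_card_filter_not (s := B) (c · = i)
    have h2 : (B.filter (c · = i)).card * 3 ≤ B.card := by
      have : ((B.filter (c · = i)).card : ℚ) * 3 ≤ B.card := by linarith
      exact_mod_cast this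
    simp only [ne_eq]
    omega

theorem IsLimitedPacking.card_le [Fintype V] {k : ℕ} {B : Finset V}
    (hB : G.IsLimitedPacking k B) : B.card ≤ G.limitedPackingNumber k := by
  classical
  exact Finset.le_sup (f := Finset.card) (by simpa using hB)

theorem IsTotalLimitedPacking.card_le [Fintype V] {k : ℕ} {B : Finset V}
    (hB : G.IsTotalLimitedPacking k B) : B.card ≤ G.totalLimitedPackingNumber k := by
  classical
  exact Finset.le_sup (f := Finset.card) (by simpa using hB)

theorem IsTree.totalLimitedPackingNumber_two_le [Fintype V] (hG : G.IsTree) :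
    G.totalLimitedPackingNumber 2 ≤ G.limitedPackingNumber 2 + Fintype.card V / 3 := by
  classical
  refine Finset.sup_le fun B hB => ?_
  obtain ⟨C, -, hC, hcard⟩ := hG.exists_isLimitedPacking_subset (Finset.mem_filter.1 hB).2
  have h1 := hC.card_le
  have h2 := Nat.div_le_div_right (c := 3) B.card_le_univ
  omega

theorem isAcyclic_pathGraph (n : ℕ) : (pathGraph n).IsAcyclic := by
  suffices h : ∀ u v : Fin n, u.val + 1 = v.val → (pathGraph n).IsBridge s(u, v) by
    rw [isAcyclic_iff_forall_adj_isBridge]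
    intro u v huv
    rcases pathGraph_adj.1 huv with h' | h'
    · exact h u v h'
    · rw [Sym2.eq_swap]
      exact h v u h'
  intro u v huv
  rw [isBridge_iff]
  rintro ⟨p⟩
  -- Without the edge `s(u, v)`, no walk leaves the initial segment ending at `u`.
  have hle : ∀ {x y : Fin n} (_ : ((pathGraph n).deleteEdges {s(u, v)}).Walk x y),
      x ≤ u → y ≤ u := by
    intro x y p
    induction p with
    | nil => exact id
    | @cons a b c hab _ ih =>
      refine fun hau => ih ?_
      simp only [deleteEdges_adj, pathGraph_adj, Set.mem_singleton_iff, Sym2.eq_iff] at hab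
      rw [Fin.ext_iff, Fin.ext_iff, Fin.ext_iff, Fin.ext_iff] at hab
      rw [Fin.le_def] at *
      omega
  have := hle p le_rfl
  rw [Fin.le_def] at this
  omega

theorem isTree_pathGraph {n : ℕ} (hn : 1 ≤ n) : (pathGraph n).IsTree := by
  have : Nonempty (Fin n) := ⟨⟨0, hn⟩⟩
  exact ⟨⟨pathGraph_preconnected n⟩, isAcyclic_pathGraph n⟩

theorem isTotalLimitedPacking_pathGraph (n : ℕ) (B : Finset (Fin n)) :
    (pathGraph n).IsTotalLimitedPacking 2 B := by
  intro v
  have hmaps : Set.MapsTo Fin.val ((B : Set (Fin n)) ∩ (pathGraph n).neighborSet v)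
      (({v.val - 1, v.val + 1} : Finset ℕ) : Set ℕ) := by
    rintro x ⟨-, hx⟩
    rw [mem_neighborSet, pathGraph_adj] at hx
    simp only [Finset.coe_insert, Finset.coe_singleton, Set.mem_insert_iff,
      Set.mem_singleton_iff]
    omega
  have := Set.ncard_le_ncard_of_injOn Fin.val hmaps Fin.val_injective.injOn
    (Finset.finite_toSet _)
  rw [Set.ncard_coe_finset] at this
  exact this.trans Finset.card_le_two

/-- The `n / 3` disjoint blocks `{3i, 3i+1, 3i+2}` are the closed neighbourhoods of their midpoints,
so each contains a vertex outside `B`. -/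
theorem IsLimitedPacking.card_le_of_pathGraph {n : ℕ} {B : Finset (Fin n)}
    (hB : (pathGraph n).IsLimitedPacking 2 B) : B.card + n / 3 ≤ n := by
  have key : ∀ i : Fin (n / 3), ∃ x : Fin n, x ∉ B ∧ x.val / 3 = i := by
    intro i
    by_contra! h
    have hi := i.isLt
    let x : Fin n := ⟨3 * i, by omega⟩
    let y : Fin n := ⟨3 * i + 1, by omega⟩
    let z : Fin n := ⟨3 * i + 2, by omega⟩
    have hmem : ∀ w : Fin n, w.val / 3 = i → w ∈ B := fun w hw => by_contra fun h' => h w h' hw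
    have hsub : (({x, y, z} : Finset (Fin n)) : Set (Fin n)) ⊆
        (B : Set (Fin n)) ∩ insert y ((pathGraph n).neighborSet y) := by
      intro w hw
      simp only [Finset.coe_insert, Finset.coe_singleton, Set.mem_insert_iff,
        Set.mem_singleton_iff, x, y, z, Fin.ext_iff] at hw
      refine ⟨hmem w (by omega), ?_⟩
      simp only [Set.mem_insert_iff, mem_neighborSet, pathGraph_adj, Fin.ext_iff, y]
      omega
    have h1 := Set.ncard_le_ncard hsub (B.finite_toSet.inter_of_left _)
    have h2 : ({x, y, z} : Finset (Fin n)).card = 3 :=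
      Finset.card_eq_three.2 ⟨x, y, z, by simp [x, y], by simp [x, z], by simp [y, z], rfl⟩
    rw [Set.ncard_coe_finset, h2] at h1
    have h3 := hB y
    omega
  choose f hf hfi using key
  have hinj : Function.Injective f := fun i j hij => by
    rw [Fin.ext_iff, ← hfi i, ← hfi j, hij]
  have h := Finset.card_le_card_of_injOn (s := Finset.univ) (t := Bᶜ) f (by simpa using hf)
    hinj.injOn
  have h' := B.card_le_univ
  rw [Finset.card_compl] at h
  simp only [Finset.card_univ, Fintype.card_fin] at h h'
  omega

end SimpleGraph

theorem mainTheorem3 :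
    (∀ {V : Type*} [Fintype V] (T : SimpleGraph V), T.IsTree →
      (T.totalLimitedPackingNumber 2 : ℤ) - (T.limitedPackingNumber 2 : ℤ)
        ≤ ⌊(Fintype.card V : ℚ) / 3⌋) ∧
    (∀ n : ℕ, 1 ≤ n → ∃ T : SimpleGraph (Fin n), T.IsTree ∧
      (T.totalLimitedPackingNumber 2 : ℤ) - (T.limitedPackingNumber 2 : ℤ)
        = ⌊(n : ℚ) / 3⌋) := by
  have hfloor : ∀ n : ℕ, ⌊(n : ℚ) / 3⌋ = ((n / 3 : ℕ) : ℤ) := fun n => by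
    exact_mod_cast Rat.floor_natCast_div_natCast n 3
  refine ⟨fun {V} _ T hT => ?_, fun n hn => ⟨SimpleGraph.pathGraph n, ?_, ?_⟩⟩
  · rw [hfloor]
    have := hT.totalLimitedPackingNumber_two_le
    omega
  · exact SimpleGraph.isTree_pathGraph hn
  · rw [hfloor]
    -- The general bound gives one inequality; the full vertex set and the block count give the
    -- other.
    have h1 := (SimpleGraph.isTree_pathGraph hn).totalLimitedPackingNumber_two_le
    have h2 := (SimpleGraph.isTotalLimitedPacking_pathGraph n Finset.univ).card_le
    have h3 : (SimpleGraph.pathGraph n).limitedPackingNumber 2 ≤ n - n / 3 := by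
      classical
      refine Finset.sup_le fun B hB => ?_
      have := (Finset.mem_filter.1 hB).2.card_le_of_pathGraph
      omega
    rw [Fintype.card_fin] at h1
    rw [Finset.card_univ, Fintype.card_fin] at h2
    omega
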